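/- Let $(M, g)$ be a Riemannian manifold of dimension $m \ge 2$ (of class $C^4$, with a metric tensor of class $C^3$), let $\nabla$ be its Levi-Civita connection and $R(u,v)w = \nabla_u\nabla_v w - \nabla_v\nabla_u w - \nabla_{[u,v]}w$ its curvature tensor, and assume that for some real numbers $\delta, \Delta$ all sectional curvatures $\sec(u,v) = \frac{\langle R(u,v)v, u\rangle}{\|u\|^2\|v\|^2 - \langle u,v\rangle^2}$ satisfy $\delta \le \sec \le \Delta$. Let $r > 0$, let $\gamma \colon [0,r] \to M$ be a unit speed geodesic, and write $\dot X = \nabla_{\partial_t} X$ for the covariant derivative of a vector field $X$ along $\gamma$. Let $X, Y$ be vector fields along $\gamma$, with $X$ twice differentiable, such that $X(t), Y(t) \perp \dot\gamma(t)$ for all $t \in [0,r]$ and \[ \ddot X + R(X, \dot\gamma)\dot\gamma = Y \quad \text{on } [0,r], \qquad X(0) = 0, \quad \dot X(0) = 0. \] Let $\eta \colon [0,r] \to \mathbb{R}$ be a continuous function with $\|Y(t)\| \le \eta(t)$ for all $t \in [0,r]$, and let $\rho \colon [0,r] \to \mathbb{R}$ be the solution of \[ \ddot\rho + \delta\rho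 = \eta, \qquad \rho(0) = 0, \quad \dot\rho(0) = 0. \] Then $\|X(t)\| \le \rho(t)$ for every $t \in [0, r]$ with $t \le \pi_{(\Delta+\delta)/2}$, that is, on $[0, \min\{r, \pi_{(\Delta+\delta)/2}\}]$, where $\pi_\kappa = \pi/\sqrt{\kappa}$ if $\kappa > 0$ and $\pi_\kappa = \infty$ if $\kappa \le 0$. -/

import Mathlib

open Bundle Set
open scoped Manifold ContDiff

noncomputable section

namespace KaulComparison

variable {E : Type*} [NormedAddCommGroup E] [NormedSpace ℝ E]
  {M : Type*} [TopologicalSpace M] [ChartedSpace E M]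

section Coordinates

variable [IsManifold 𝓘(ℝ, E) 1 M]

/-- The coordinates of a tangent vector `v` at `x`, in the chart `chartAt E p`
(meaningful if `x` is in the domain of this chart). -/
def coordAt (p x : M) (v : TangentSpace 𝓘(ℝ, E) x) : E :=
  (trivializationAt E (TangentSpace 𝓘(ℝ, E)) p).continuousLinearMapAt ℝ x v

variable [RiemannianBundle (fun x : M ↦ TangentSpace 𝓘(ℝ, E) x)]

/-- The metric tensor in the chart `chartAt E p`, as a bilinear form on `E` that depends on the
point `y` of the target of the chart: `gram p y u v = ∑ g_{ij}(y) u^i v^j`. -/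
def gram (p : M) (y : E) : E →L[ℝ] E →L[ℝ] ℝ :=
  let x : M := (chartAt E p).symm y
  let L : E →L[ℝ] TangentSpace 𝓘(ℝ, E) x :=
    (trivializationAt E (TangentSpace 𝓘(ℝ, E)) p).symmL ℝ x
  let g : TangentSpace 𝓘(ℝ, E) x →L[ℝ] TangentSpace 𝓘(ℝ, E) x →L[ℝ] ℝ := innerSL ℝ
  g.bilinearComp L L

/-- The Christoffel symbols of the first kind in the chart `chartAt E p`: the linear form
`w ↦ (1/2) (∂_u g (v, w) + ∂_v g (u, w) - ∂_w g (u, v))`. -/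
def christoffelFirst (p : M) (y u v : E) : E →L[ℝ] ℝ :=
  (1 / 2 : ℝ) • (fderiv ℝ (gram p) y u v + fderiv ℝ (gram p) y v u
    - ((fderiv ℝ (gram p) y).flip u).flip v)

/-- The Christoffel symbols of the Levi-Civita connection in the chart `chartAt E p`, as a bilinear
map: `christoffel p y u v = ∑ Γ^k_{ij}(y) u^i v^j ∂_k`. They are obtained from
those of the first kind by raising the index with the inverse of the metric tensor. -/
def christoffel (p : M) (y u v : E) : E :=
  (gram p y).inverse (christoffelFirst p y u v)

/-- The Riemann curvature tensor
`R(u, v) w = ∇_u ∇_v w - ∇_v ∇_u w - ∇_{[u, v]} w` at the point `x`, computed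
in the chart at `x`, in which tangent vectors at `x` are their own coordinates. -/
def riemann (x : M) (u v w : TangentSpace 𝓘(ℝ, E) x) : TangentSpace 𝓘(ℝ, E) x :=
  let y : E := chartAt E x x
  let u' : E := coordAt x x u
  let v' : E := coordAt x x v
  let w' : E := coordAt x x w
  (trivializationAt E (TangentSpace 𝓘(ℝ, E)) x).symmL ℝ x
    (fderiv ℝ (fun z ↦ christoffel x z v' w') y u'
      - fderiv ℝ (fun z ↦ christoffel x z u' w') y v'
      + christoffel x y u' (christoffel x y v' w')
      - christoffel x y v' (christoffel x y u' w'))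

/-- The sectional curvature of the plane spanned by `u` and `v` (if they are linearly
independent). -/
def sec (x : M) (u v : TangentSpace 𝓘(ℝ, E) x) : ℝ :=
  inner ℝ (riemann x u v v) u / (‖u‖ ^ 2 * ‖v‖ ^ 2 - inner ℝ u v ^ 2)

/-- The velocity of a curve defined on the interval `[0, r]`. -/
def velocity (γ : ℝ → M) (r t : ℝ) : TangentSpace 𝓘(ℝ, E) (γ t) :=
  mfderivWithin 𝓘(ℝ, ℝ) 𝓘(ℝ, E) γ (Icc 0 r) t (1 : ℝ)

/-- The vector field `X` along `γ : [0, r] → M` is differentiable, with covariant derivative `Z`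
along `γ`: in every chart, `Z^k = (X^k)' + ∑ Γ^k_{ij} (γ^i)' X^j`. -/
def HasCovDerivAlong (γ : ℝ → M) (r : ℝ) (X Z : ∀ t, TangentSpace 𝓘(ℝ, E) (γ t)) : Prop :=
  ∀ p : M, ∀ t ∈ Icc 0 r, γ t ∈ (chartAt E p).source →
    HasDerivWithinAt (fun τ ↦ coordAt p (γ τ) (X τ))
      (coordAt p (γ t) (Z t)
        - christoffel p (chartAt E p (γ t))
            (coordAt p (γ t) (velocity γ r t)) (coordAt p (γ t) (X t)))
      (Icc 0 r) t

/-- Unit speed geodesics `γ : [0, r] → M`. -/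
structure IsGeodesic (γ : ℝ → M) (r : ℝ) : Prop where
  contMDiffOn : ContMDiffOn 𝓘(ℝ, ℝ) 𝓘(ℝ, E) 2 γ (Icc 0 r)
  norm_velocity : ∀ t ∈ Icc 0 r, ‖(velocity γ r t : TangentSpace 𝓘(ℝ, E) (γ t))‖ = 1
  covDeriv_velocity : HasCovDerivAlong (E := E) γ r (velocity γ r) (fun _ ↦ 0)

end Coordinates

/-- The first positive zero `π_κ ∈ (0, ∞]` of the generalized sine function: the solution of
`x'' + κ x = 0`, `x 0 = 0`, `x' 0 = 1`. -/
def genPi (κ : ℝ) : EReal :=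
  if 0 < κ then ((Real.pi / Real.sqrt κ : ℝ) : EReal) else ⊤

end KaulComparison

end

/-! ### The metric tensor in a chart. -/

namespace KaulComparison
open Filter Topology

variable {E : Type*} [NormedAddCommGroup E] [NormedSpace ℝ E]
  {M : Type*} [TopologicalSpace M] [ChartedSpace E M] [IsManifold 𝓘(ℝ, E) 1 M]


/-! Put `c = (Δ + δ) / 2`, `ε = (Δ - δ) / 2`, and let `sn`, `cn` be the generalized sine and cosine
for `c`. By the symmetries of the curvature tensor, `X ↦ R(X, γ')γ'` is self-adjoint on the normal
space, with quadratic form between `δ` and `Δ`, so it differs from `c X` by at most `ε ‖X‖`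
(`norm_riemann_sub_smul_le`). For fixed `t`, the field `V(s) = sn(t-s) X'(s) + cn(t-s) X(s)` goes
from `0` to `X(t)`, and its covariant derivative is `sn(t-s) (Y - (R(X, γ')γ' - c X))`. As `sn ≥ 0`
up to `π_c`, integration (`HasCovDerivAlong.norm_le`) gives `‖X(t)‖ ≤ ∫ sn(t-s) (η + ε ‖X‖) ds`.
Since `c - ε = δ`, the function `ρ` satisfies the same relation with equality, and a Grönwall
argument yields `‖X‖ ≤ ρ` (`le_of_integrated_comparison`). Compatibility of the connection with the
metric and the symmetries of curvature are computed in charts. -/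

theorem symmL_coordAt {p x : M} (hx : x ∈ (chartAt E p).source) (v : TangentSpace 𝓘(ℝ, E) x) :
    (trivializationAt E (TangentSpace 𝓘(ℝ, E)) p).symmL ℝ x (coordAt p x v) = v :=
  (trivializationAt E (TangentSpace 𝓘(ℝ, E)) p).symmL_continuousLinearMapAt (R := ℝ)
    (by simpa using hx) v

theorem coordAt_symmL {p x : M} (hx : x ∈ (chartAt E p).source) (v : E) :
    coordAt p x ((trivializationAt E (TangentSpace 𝓘(ℝ, E)) p).symmL ℝ x v) = v :=
  (trivializationAt E (TangentSpace 𝓘(ℝ, E)) p).continuousLinearMapAt_symmL (R := ℝ)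
    (by simpa using hx) v

variable [RiemannianBundle (fun x : M ↦ TangentSpace 𝓘(ℝ, E) x)]

theorem gram_apply (p : M) (y u v : E) :
    gram p y u v = inner ℝ
      ((trivializationAt E (TangentSpace 𝓘(ℝ, E)) p).symmL ℝ ((chartAt E p).symm y) u)
      ((trivializationAt E (TangentSpace 𝓘(ℝ, E)) p).symmL ℝ ((chartAt E p).symm y) v) := rfl

theorem gram_symm (p : M) (y u v : E) : gram p y u v = gram p y v u := by
  rw [gram_apply, gram_apply, real_inner_comm]

theorem gram_coordAt {p x : M} (hx : x ∈ (chartAt E p).source)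
    (v w : TangentSpace 𝓘(ℝ, E) x) :
    gram p (chartAt E p x) (coordAt p x v) (coordAt p x w) = inner ℝ v w := by
  -- The base point is generalized because the fibre type depends on it, and the left inverse law of
  -- the chart is only a propositional equality.
  have h : ∀ x', x' = x → ∀ a b : E,
      inner ℝ ((trivializationAt E (TangentSpace 𝓘(ℝ, E)) p).symmL ℝ x' a)
      ((trivializationAt E (TangentSpace 𝓘(ℝ, E)) p).symmL ℝ x' b) =
      inner ℝ ((trivializationAt E (TangentSpace 𝓘(ℝ, E)) p).symmL ℝ x a)
      ((trivializationAt E (TangentSpace 𝓘(ℝ, E)) p).symmL ℝ x b) := by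
    rintro x' rfl a b; rfl
  rw [gram_apply, h _ ((chartAt E p).left_inv hx), symmL_coordAt hx, symmL_coordAt hx]

/-- Definiteness gives injectivity, and `E` and its dual have the same finite dimension. -/
theorem gram_isInvertible [FiniteDimensional ℝ E] {p : M} {y : E} (hy : y ∈ (chartAt E p).target) :
    (gram p y).IsInvertible := by
  have hinj : Function.Injective (gram p y) := by
    refine (injective_iff_map_eq_zero (gram p y)).2 fun u hu ↦ ?_
    have h0 : gram p y u u = 0 := by rw [hu]; rfl
    rw [gram_apply, inner_self_eq_zero] at h0
    rw [← coordAt_symmL ((chartAt E p).map_target hy) u, h0]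
    simp [coordAt]
  have hfin : Module.finrank ℝ E = Module.finrank ℝ (E →L[ℝ] ℝ) := by
    rw [← (LinearMap.toContinuousLinearMap (𝕜 := ℝ) (E := E) (F' := ℝ)).finrank_eq]
    exact (Subspace.dual_finrank_eq (K := ℝ) (V := E)).symm
  refine ⟨(LinearEquiv.ofInjectiveOfFinrankEq (gram p y : E →ₗ[ℝ] E →L[ℝ] ℝ) hinj
    hfin).toContinuousLinearEquiv, ?_⟩
  ext; rfl

theorem contMDiffOn_inner_symmL
    {EB : Type*} [NormedAddCommGroup EB] [NormedSpace ℝ EB]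
    {HB : Type*} [TopologicalSpace HB] {IB : ModelWithCorners ℝ EB HB} {n : WithTop ℕ∞}
    {B : Type*} [TopologicalSpace B] [ChartedSpace HB B]
    {F : Type*} [NormedAddCommGroup F] [NormedSpace ℝ F]
    {V : B → Type*} [TopologicalSpace (TotalSpace F V)] [∀ x, NormedAddCommGroup (V x)]
    [∀ x, InnerProductSpace ℝ (V x)] [FiberBundle F V] [VectorBundle ℝ F V]
    [IsManifold IB n B] [ContMDiffVectorBundle n F V IB]
    [IsContMDiffRiemannianBundle IB n F V] (p : B) (u v : F) :
    ContMDiffOn IB 𝓘(ℝ) n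
      (fun x ↦ (inner ℝ ((trivializationAt F V p).symmL ℝ x u)
        ((trivializationAt F V p).symmL ℝ x v) : ℝ)) (trivializationAt F V p).baseSet := by
  have h : ∀ u : F, ContMDiffOn IB (IB.prod 𝓘(ℝ, F)) n
      (fun x ↦ (⟨x, (trivializationAt F V p).symmL ℝ x u⟩ : TotalSpace F V))
      (trivializationAt F V p).baseSet := by
    intro u
    refine ((trivializationAt F V p).contMDiffOn_symm (IB := IB) (n := n) |>.comp
      (contMDiffOn_id.prodMk (contMDiffOn_const (c := u))) fun x hx ↦ ?_).congr fun x hx ↦ ?_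
    · simpa [Trivialization.mem_target] using hx
    · exact (congrArg (TotalSpace.mk x) (Trivialization.symmL_apply _ hx u)).trans
        (Trivialization.mk_symm _ hx u)
  exact (h u).inner_bundle (h v)

theorem gram_contDiffAt [FiniteDimensional ℝ E] [IsManifold 𝓘(ℝ, E) 4 M]
    [IsContMDiffRiemannianBundle 𝓘(ℝ, E) 3 E (fun x : M ↦ TangentSpace 𝓘(ℝ, E) x)]
    {p : M} {y : E} (hy : y ∈ (chartAt E p).target) : ContDiffAt ℝ 3 (gram p) y := by
  -- The tangent bundle loses one derivative: a `C^(3+1)` manifold has a `C^3` tangent bundle.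
  have : IsManifold 𝓘(ℝ, E) (3 + 1) M := by
    convert! (inferInstance : IsManifold 𝓘(ℝ, E) 4 M)
  have : ContMDiffVectorBundle 3 E (TangentSpace 𝓘(ℝ, E) : M → Type _) 𝓘(ℝ, E) :=
    TangentBundle.contMDiffVectorBundle
  have : IsManifold 𝓘(ℝ, E) 3 M := .of_le (n := 3 + 1) le_self_add
  have h1 : ContMDiffOn 𝓘(ℝ, E) 𝓘(ℝ, E) 3 (chartAt E p).symm (chartAt E p).target :=
    contMDiffOn_chart_symm
  have hon : ContDiffOn ℝ 3 (gram p) (chartAt E p).target := by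
    refine contDiffOn_clm_apply.2 fun u ↦ contDiffOn_clm_apply.2 fun v ↦ ?_
    have h2 := contMDiffOn_inner_symmL (IB := 𝓘(ℝ, E)) (n := 3) (F := E)
      (V := fun x : M ↦ TangentSpace 𝓘(ℝ, E) x) p u v
    exact (h2.comp h1 fun z hz ↦ by simpa using (chartAt E p).map_target hz).contDiffOn
  exact hon.contDiffAt ((chartAt E p).open_target.mem_nhds hy)

end KaulComparison

/-! ### Levi-Civita connection and curvature of a metric on an open subset of a vector space. -/

namespace KaulComparison
set_option maxSynthPendingDepth 3
open Filter Topology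

section Calculus

variable {E : Type*} [NormedAddCommGroup E] [NormedSpace ℝ E]
  {G : E → E →L[ℝ] E →L[ℝ] ℝ} {U : Set E} {y : E}

/-- A nondegenerate metric tensor of class `C^3` on an open subset of a vector space. -/
structure IsMetricOn (G : E → E →L[ℝ] E →L[ℝ] ℝ) (U : Set E) : Prop where
  isOpen : IsOpen U
  contDiffAt : ∀ {y}, y ∈ U → ContDiffAt ℝ 3 G y
  symm : ∀ y u v, G y u v = G y v u
  isInvertible : ∀ {y}, y ∈ U → (G y).IsInvertible

/-- The Christoffel symbols of the first kind of a metric tensor. -/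
noncomputable def christoffelFirstOf (G : E → E →L[ℝ] E →L[ℝ] ℝ) (y u v : E) : E →L[ℝ] ℝ :=
  (1 / 2 : ℝ) • (fderiv ℝ G y u v + fderiv ℝ G y v u - ((fderiv ℝ G y).flip u).flip v)

/-- The Christoffel symbols of the Levi-Civita connection of a metric tensor. -/
noncomputable def christoffelOf (G : E → E →L[ℝ] E →L[ℝ] ℝ) (y u v : E) : E :=
  (G y).inverse (christoffelFirstOf G y u v)

theorem IsMetricOn.differentiableAt (hG : IsMetricOn G U) (hy : y ∈ U) :
    DifferentiableAt ℝ G y :=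
  (hG.contDiffAt hy).differentiableAt (by norm_num)

theorem IsMetricOn.fderiv_differentiableAt (hG : IsMetricOn G U) (hy : y ∈ U) :
    DifferentiableAt ℝ (fderiv ℝ G) y :=
  ((hG.contDiffAt hy).fderiv_right (m := 1) (by norm_num)).differentiableAt (by norm_num)

theorem IsMetricOn.fderiv_symm (hG : IsMetricOn G U) (hy : y ∈ U) (u v w : E) :
    fderiv ℝ G y u v w = fderiv ℝ G y u w v := by
  have h : ∀ a b : E, HasFDerivAt (fun z ↦ G z a b)
      (((fderiv ℝ G y).flip a).flip b) y := fun a b ↦ by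
    have := ((hG.differentiableAt hy).hasFDerivAt.clm_apply (hasFDerivAt_const a y)).clm_apply
      (hasFDerivAt_const b y)
    refine this.congr_fderiv ?_
    ext; simp
  have h' : (fun z ↦ G z v w) = fun z ↦ G z w v := funext fun z ↦ hG.symm z v w
  have := (h v w).unique (h' ▸ h w v)
  exact congrArg (fun L : E →L[ℝ] ℝ ↦ L u) this

theorem IsMetricOn.hasFDerivAt_fderiv_apply (hG : IsMetricOn G U) (hy : y ∈ U) (a b c : E) :
    HasFDerivAt (fun z ↦ fderiv ℝ G z a b c)
      ((((fderiv ℝ (fderiv ℝ G) y).flip a).flip b).flip c) y := by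
  have := (((hG.fderiv_differentiableAt hy).hasFDerivAt.clm_apply
    (hasFDerivAt_const a y)).clm_apply (hasFDerivAt_const b y)).clm_apply (hasFDerivAt_const c y)
  refine this.congr_fderiv ?_
  ext; simp

theorem IsMetricOn.fderiv_fderiv_symm (hG : IsMetricOn G U) (hy : y ∈ U) (u a b c : E) :
    fderiv ℝ (fderiv ℝ G) y u a b c = fderiv ℝ (fderiv ℝ G) y u a c b := by
  have h : (fun z ↦ fderiv ℝ G z a b c) =ᶠ[𝓝 y] fun z ↦ fderiv ℝ G z a c b := by
    filter_upwards [hG.isOpen.mem_nhds hy] with z hz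
    exact hG.fderiv_symm hz a b c
  have := (hG.hasFDerivAt_fderiv_apply hy a b c).unique
    ((hG.hasFDerivAt_fderiv_apply hy a c b).congr_of_eventuallyEq h)
  exact congrArg (fun L : E →L[ℝ] ℝ ↦ L u) this

theorem IsMetricOn.fderiv_fderiv_comm (hG : IsMetricOn G U) (hy : y ∈ U) (u a b c : E) :
    fderiv ℝ (fderiv ℝ G) y u a b c = fderiv ℝ (fderiv ℝ G) y a u b c := by
  have h := (hG.contDiffAt hy).isSymmSndFDerivAt (by simp; norm_cast)
  rw [h.eq u a]

theorem christoffelFirstOf_apply (G : E → E →L[ℝ] E →L[ℝ] ℝ) (y u v w : E) :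
    christoffelFirstOf G y u v w = 1 / 2 * (fderiv ℝ G y u v w + fderiv ℝ G y v u w
      - fderiv ℝ G y w u v) := rfl

theorem IsMetricOn.apply_christoffelOf (hG : IsMetricOn G U) (hy : y ∈ U) (u v : E) :
    G y (christoffelOf G y u v) = christoffelFirstOf G y u v :=
  (hG.isInvertible hy).self_apply_inverse _

/-- Compatibility `∇g = 0`: in the sum of the two first-kind symbols all but one derivative cancel.
-/
theorem IsMetricOn.fderiv_eq (hG : IsMetricOn G U) (hy : y ∈ U) (u v w : E) :
    fderiv ℝ G y u v w =
      G y (christoffelOf G y u v) w + G y (christoffelOf G y u w) v := by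
  rw [hG.apply_christoffelOf hy, hG.apply_christoffelOf hy, christoffelFirstOf_apply,
    christoffelFirstOf_apply,
    hG.fderiv_symm hy u w v, hG.fderiv_symm hy v u w, hG.fderiv_symm hy w u v]
  ring

theorem IsMetricOn.christoffel_symm (hG : IsMetricOn G U) (hy : y ∈ U) (u v : E) :
    christoffelOf G y u v = christoffelOf G y v u := by
  have : christoffelFirstOf G y u v = christoffelFirstOf G y v u := by
    ext w
    rw [christoffelFirstOf_apply, christoffelFirstOf_apply, hG.fderiv_symm hy w u v]
    ring
  rw [christoffelOf, this, christoffelOf]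

theorem christoffelOf_linear (G : E → E →L[ℝ] E →L[ℝ] ℝ) (y u v w : E) (a b : ℝ) :
    christoffelOf G y u (a • v + b • w) = a • christoffelOf G y u v + b • christoffelOf G y u w := by
  have : christoffelFirstOf G y u (a • v + b • w)
      = a • christoffelFirstOf G y u v + b • christoffelFirstOf G y u w := by
    ext z
    simp only [christoffelFirstOf_apply, map_add, map_smul, add_apply,
      smul_apply, smul_eq_mul]
    ring
  rw [christoffelOf, this, map_add, map_smul, map_smul, christoffelOf, christoffelOf]

theorem IsMetricOn.christoffelFirst_differentiableAt (hG : IsMetricOn G U) (hy : y ∈ U) (u v : E) :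
    DifferentiableAt ℝ (fun z ↦ christoffelFirstOf G z u v) y := by
  have hD := hG.fderiv_differentiableAt hy
  have hflip : DifferentiableAt ℝ (fun z ↦ ((fderiv ℝ G z).flip u).flip v) y := by
    have h1 : DifferentiableAt ℝ (fun z ↦ (fderiv ℝ G z).flip u) y :=
      ((ContinuousLinearMap.flipₗᵢ ℝ E E (E →L[ℝ] ℝ)).toContinuousLinearEquiv.differentiableAt.comp
        y hD).clm_apply (differentiableAt_const u)
    exact ((ContinuousLinearMap.flipₗᵢ ℝ E E ℝ).toContinuousLinearEquiv.differentiableAt.comp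
      y h1).clm_apply (differentiableAt_const v)
  have h1 : ∀ a b : E, DifferentiableAt ℝ (fun z ↦ fderiv ℝ G z a b) y := fun a b ↦
    (hD.clm_apply (differentiableAt_const a)).clm_apply (differentiableAt_const b)
  exact (((h1 u v).add (h1 v u)).sub hflip).const_smul (1 / 2 : ℝ)

theorem IsMetricOn.christoffel_differentiableAt [FiniteDimensional ℝ E] (hG : IsMetricOn G U)
    (hy : y ∈ U) (u v : E) :
    DifferentiableAt ℝ (fun z ↦ christoffelOf G z u v) y := by
  have h : DifferentiableAt ℝ (fun z ↦ (G z).inverse) y :=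
    (((hG.isInvertible hy).contDiffAt_map_inverse (n := 1)).differentiableAt
      (by norm_num)).comp y (hG.differentiableAt hy)
  exact h.clm_apply (hG.christoffelFirst_differentiableAt hy u v)

theorem IsMetricOn.fderiv_christoffelFirstOf (hG : IsMetricOn G U) (hy : y ∈ U) (u v w z : E) :
    fderiv ℝ (fun z ↦ christoffelFirstOf G z v w) y u z =
      1 / 2 * (fderiv ℝ (fderiv ℝ G) y u v w z + fderiv ℝ (fderiv ℝ G) y u w v z
        - fderiv ℝ (fderiv ℝ G) y u z v w) := by
  have h1 := (hG.christoffelFirst_differentiableAt hy v w).hasFDerivAt.clm_apply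
    (hasFDerivAt_const z y)
  have h2 := (((hG.hasFDerivAt_fderiv_apply hy v w z).add
    (hG.hasFDerivAt_fderiv_apply hy w v z)).sub
    (hG.hasFDerivAt_fderiv_apply hy z v w)).const_mul (1 / 2 : ℝ)
  simpa using congrArg (fun L : E →L[ℝ] ℝ ↦ L u) (h1.unique h2)

/-- Differentiating the identity `G(Γ(v, w)) = christoffelFirstOf G v w` avoids computing the
derivative of the inverse metric; `∇g = 0` then eliminates the first derivatives of `G`. -/
theorem IsMetricOn.apply_fderiv_christoffelOf [FiniteDimensional ℝ E] (hG : IsMetricOn G U)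
    (hy : y ∈ U) (u v w z : E) :
    G y (fderiv ℝ (fun z ↦ christoffelOf G z v w) y u + christoffelOf G y u (christoffelOf G y v w))
      z = 1 / 2 * (fderiv ℝ (fderiv ℝ G) y u v w z
        + fderiv ℝ (fderiv ℝ G) y u w v z - fderiv ℝ (fderiv ℝ G) y u z v w)
        - G y (christoffelOf G y u z) (christoffelOf G y v w) := by
  have h1 := (hG.differentiableAt hy).hasFDerivAt.clm_apply
    (hG.christoffel_differentiableAt hy v w).hasFDerivAt
  have h2 : (fun z ↦ G z (christoffelOf G z v w)) =ᶠ[𝓝 y]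
      fun z ↦ christoffelFirstOf G z v w := by
    filter_upwards [hG.isOpen.mem_nhds hy] with z hz
    exact hG.apply_christoffelOf hz v w
  have h3 := h1.unique ((hG.christoffelFirst_differentiableAt hy v w).hasFDerivAt.congr_of_eventuallyEq
    h2)
  have h4 := congrArg (fun L : E →L[ℝ] E →L[ℝ] ℝ ↦ L u z) h3
  simp only [add_apply, ContinuousLinearMap.comp_apply,
    ContinuousLinearMap.flip_apply, hG.fderiv_christoffelFirstOf hy, hG.fderiv_eq hy] at h4
  rw [map_add, add_apply, ← h4]
  ring

variable (G y) in
/-- The coordinate expression of the curvature tensor. -/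
noncomputable def riemannCoord (u v w : E) : E :=
  fderiv ℝ (fun z ↦ christoffelOf G z v w) y u - fderiv ℝ (fun z ↦ christoffelOf G z u w) y v
    + christoffelOf G y u (christoffelOf G y v w) - christoffelOf G y v (christoffelOf G y u w)

/-- The curvature tensor in terms of second derivatives of the metric tensor. -/
theorem IsMetricOn.apply_riemannCoord [FiniteDimensional ℝ E] (hG : IsMetricOn G U)
    (hy : y ∈ U) (u v w z : E) :
    G y (riemannCoord G y u v w) z =
      1 / 2 * (fderiv ℝ (fderiv ℝ G) y u w v z - fderiv ℝ (fderiv ℝ G) y u z v w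
          - fderiv ℝ (fderiv ℝ G) y v w u z + fderiv ℝ (fderiv ℝ G) y v z u w)
        - G y (christoffelOf G y u z) (christoffelOf G y v w)
        + G y (christoffelOf G y v z) (christoffelOf G y u w) := by
  have h1 := hG.apply_fderiv_christoffelOf hy u v w z
  have h2 := hG.apply_fderiv_christoffelOf hy v u w z
  rw [hG.fderiv_fderiv_comm hy v u] at h2
  simp only [riemannCoord, map_add, map_sub, add_apply,
    sub_apply] at h1 h2 ⊢
  linarith

/-- Visible in the second-derivative formula, once Schwarz's theorem and the symmetry of `G` and `Γ`
are applied. -/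
theorem IsMetricOn.apply_riemannCoord_symm [FiniteDimensional ℝ E] (hG : IsMetricOn G U)
    (hy : y ∈ U) (u e z : E) :
    G y (riemannCoord G y u e e) z = G y (riemannCoord G y z e e) u := by
  rw [hG.apply_riemannCoord hy, hG.apply_riemannCoord hy,
    hG.fderiv_fderiv_comm hy z u e e, hG.fderiv_fderiv_comm hy u e e z,
    hG.fderiv_fderiv_comm hy z e e u, hG.fderiv_fderiv_symm hy e u e z,
    hG.fderiv_fderiv_symm hy e z e u, hG.fderiv_fderiv_symm hy e e z u,
    hG.christoffel_symm hy z u, hG.symm _ (christoffelOf G y e z), hG.christoffel_symm hy z e,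
    hG.christoffel_symm hy u e]
  ring

theorem IsMetricOn.apply_riemannCoord_self [FiniteDimensional ℝ E] (hG : IsMetricOn G U)
    (hy : y ∈ U) (u e : E) :
    G y (riemannCoord G y u e e) e = 0 := by
  rw [hG.apply_riemannCoord hy, hG.symm _ (christoffelOf G _ e e)]
  ring

theorem IsMetricOn.hasDerivWithinAt_apply [FiniteDimensional ℝ E] (hG : IsMetricOn G U)
    {c v w : ℝ → E} {c' v' w' : E} {s : Set ℝ} {t : ℝ} (ht : c t ∈ U)
    (hc : HasDerivWithinAt c c' s t)
    (hv : HasDerivWithinAt v (v' - christoffelOf G (c t) c' (v t)) s t)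
    (hw : HasDerivWithinAt w (w' - christoffelOf G (c t) c' (w t)) s t) :
    HasDerivWithinAt (fun τ ↦ G (c τ) (v τ) (w τ))
      (G (c t) v' (w t) + G (c t) (v t) w') s t := by
  have h := (((hG.differentiableAt ht).hasFDerivAt.comp_hasDerivWithinAt t hc).clm_apply
    hv).clm_apply hw
  refine h.congr_deriv ?_
  simp only [Function.comp_apply, add_apply, map_sub, sub_apply, hG.fderiv_eq ht]
  rw [hG.symm _ (christoffelOf G _ c' (w t))]
  ring

end Calculus

/-! ### Transfer of the curvature symmetries to the manifold. -/

section

variable {E : Type*} [NormedAddCommGroup E] [NormedSpace ℝ E]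
  {M : Type*} [TopologicalSpace M] [ChartedSpace E M] [IsManifold 𝓘(ℝ, E) 1 M]
  [RiemannianBundle (fun x : M ↦ TangentSpace 𝓘(ℝ, E) x)]

theorem christoffel_eq (p : M) : christoffel (E := E) p = christoffelOf (gram p) := rfl

end

variable {E : Type*} [NormedAddCommGroup E] [NormedSpace ℝ E] [FiniteDimensional ℝ E]
  {M : Type*} [TopologicalSpace M] [ChartedSpace E M] [IsManifold 𝓘(ℝ, E) 1 M]
  [IsManifold 𝓘(ℝ, E) 4 M] [RiemannianBundle (fun x : M ↦ TangentSpace 𝓘(ℝ, E) x)]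
  [IsContMDiffRiemannianBundle 𝓘(ℝ, E) 3 E (fun x : M ↦ TangentSpace 𝓘(ℝ, E) x)]


theorem isMetricOn_gram (p : M) : IsMetricOn (gram p) (chartAt E p).target where
  isOpen := (chartAt E p).open_target
  contDiffAt := gram_contDiffAt
  symm := gram_symm p
  isInvertible := gram_isInvertible

omit [FiniteDimensional ℝ E] [IsManifold 𝓘(ℝ, E) 4 M]
  [IsContMDiffRiemannianBundle 𝓘(ℝ, E) 3 E (fun x : M ↦ TangentSpace 𝓘(ℝ, E) x)] in
theorem inner_riemann {x : M} (u v w z : TangentSpace 𝓘(ℝ, E) x) :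
    inner ℝ (riemann x u v w) z = gram x (chartAt E x x)
      (riemannCoord (gram x) (chartAt E x x) (coordAt x x u) (coordAt x x v) (coordAt x x w))
      (coordAt x x z) := by
  have hx := mem_chart_source E x
  rw [← gram_coordAt hx, riemann, coordAt_symmL hx, riemannCoord, christoffel_eq]

theorem inner_riemann_symm {x : M} (u e z : TangentSpace 𝓘(ℝ, E) x) :
    inner ℝ (riemann x u e e) z = inner ℝ (riemann x z e e) u := by
  rw [inner_riemann, inner_riemann, (isMetricOn_gram x).apply_riemannCoord_symm (mem_chart_target E x)]

theorem inner_riemann_self {x : M} (u e : TangentSpace 𝓘(ℝ, E) x) :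
    inner ℝ (riemann x u e e) e = 0 := by
  rw [inner_riemann, (isMetricOn_gram x).apply_riemannCoord_self (mem_chart_target E x)]

end KaulComparison

/-! ### Covariant derivatives along curves. -/

namespace KaulComparison
set_option maxSynthPendingDepth 3
open Filter Topology

variable {E : Type*} [NormedAddCommGroup E] [NormedSpace ℝ E] [FiniteDimensional ℝ E]
  {M : Type*} [TopologicalSpace M] [ChartedSpace E M] [IsManifold 𝓘(ℝ, E) 1 M]
  [IsManifold 𝓘(ℝ, E) 4 M] [RiemannianBundle (fun x : M ↦ TangentSpace 𝓘(ℝ, E) x)]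
  [IsContMDiffRiemannianBundle 𝓘(ℝ, E) 3 E (fun x : M ↦ TangentSpace 𝓘(ℝ, E) x)]

omit [FiniteDimensional ℝ E] [IsManifold 𝓘(ℝ, E) 4 M]
  [RiemannianBundle (fun x : M ↦ TangentSpace 𝓘(ℝ, E) x)]
  [IsContMDiffRiemannianBundle 𝓘(ℝ, E) 3 E (fun x : M ↦ TangentSpace 𝓘(ℝ, E) x)] in
theorem hasDerivWithinAt_chartAt_comp {γ : ℝ → M} {r t : ℝ}
    (hγ : MDifferentiableWithinAt 𝓘(ℝ, ℝ) 𝓘(ℝ, E) γ (Icc 0 r) t) {p : M}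
    (hp : γ t ∈ (chartAt E p).source) :
    HasDerivWithinAt (fun τ ↦ chartAt E p (γ τ)) (coordAt p (γ t) (velocity γ r t)) (Icc 0 r) t := by
  have h1 : HasMFDerivAt 𝓘(ℝ, E) 𝓘(ℝ, E) (extChartAt 𝓘(ℝ, E) p) (γ t)
      (mfderiv 𝓘(ℝ, E) 𝓘(ℝ, E) (extChartAt 𝓘(ℝ, E) p) (γ t)) :=
    (mdifferentiableAt_extChartAt hp).hasMFDerivAt
  have h2 : HasFDerivWithinAt (fun τ ↦ chartAt E p (γ τ))
      ((mfderiv 𝓘(ℝ, E) 𝓘(ℝ, E) (extChartAt 𝓘(ℝ, E) p) (γ t)).comp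
        (mfderivWithin 𝓘(ℝ, ℝ) 𝓘(ℝ, E) γ (Icc 0 r) t) : ℝ →L[ℝ] E) (Icc 0 r) t :=
    (h1.comp_hasMFDerivWithinAt t hγ.hasMFDerivWithinAt).hasFDerivWithinAt
  rw [← TangentBundle.continuousLinearMapAt_trivializationAt hp] at h2
  -- Stated for an arbitrary `L : ℝ →L[ℝ] E`, since the actual derivative is a composite typed
  -- through tangent spaces.
  have h3 : ∀ L : ℝ →L[ℝ] E, HasFDerivWithinAt (fun τ ↦ chartAt E p (γ τ)) L (Icc 0 r) t →
      HasDerivWithinAt (fun τ ↦ chartAt E p (γ τ)) (L 1) (Icc 0 r) t :=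
    fun L hL ↦ hL.hasDerivWithinAt
  exact h3 _ h2

theorem HasCovDerivAlong.hasDerivWithinAt_inner {γ : ℝ → M} {r : ℝ}
    (hγ : MDifferentiableOn 𝓘(ℝ, ℝ) 𝓘(ℝ, E) γ (Icc 0 r))
    {V V' W W' : ∀ t, TangentSpace 𝓘(ℝ, E) (γ t)} (hV : HasCovDerivAlong γ r V V')
    (hW : HasCovDerivAlong γ r W W') {t : ℝ} (ht : t ∈ Icc 0 r) :
    HasDerivWithinAt (fun τ ↦ (inner ℝ (V τ) (W τ) : ℝ))
      (inner ℝ (V' t) (W t) + inner ℝ (V t) (W' t)) (Icc 0 r) t := by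
  have hp := mem_chart_source E (γ t)
  have hy := mem_chart_target E (γ t)
  have h1 := (isMetricOn_gram (E := E) (γ t)).hasDerivWithinAt_apply hy
    (hasDerivWithinAt_chartAt_comp (hγ t ht) hp) (hV (γ t) t ht hp) (hW (γ t) t ht hp)
  have hev : ∀ᶠ τ in 𝓝[Icc 0 r] t, γ τ ∈ (chartAt E (γ t)).source :=
    (hγ t ht).continuousWithinAt.preimage_mem_nhdsWithin ((chartAt E (γ t)).open_source.mem_nhds hp)
  rw [gram_coordAt hp, gram_coordAt hp] at h1
  exact h1.congr_of_eventuallyEq (hev.mono fun τ hτ ↦ (gram_coordAt hτ _ _).symm)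
    (gram_coordAt hp _ _).symm

omit [FiniteDimensional ℝ E] [IsManifold 𝓘(ℝ, E) 4 M]
  [IsContMDiffRiemannianBundle 𝓘(ℝ, E) 3 E (fun x : M ↦ TangentSpace 𝓘(ℝ, E) x)] in
theorem HasCovDerivAlong.smul_add_smul {γ : ℝ → M} {r : ℝ}
    {V V' W W' : ∀ t, TangentSpace 𝓘(ℝ, E) (γ t)} (hV : HasCovDerivAlong γ r V V')
    (hW : HasCovDerivAlong γ r W W') {a a' b b' : ℝ → ℝ}
    (ha : ∀ t, HasDerivAt a (a' t) t) (hb : ∀ t, HasDerivAt b (b' t) t) :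
    HasCovDerivAlong γ r (fun t ↦ a t • V t + b t • W t)
      (fun t ↦ a t • V' t + a' t • V t + b t • W' t + b' t • W t) := by
  intro p t ht hp
  have h1 := ((ha t).hasDerivWithinAt.smul (hV p t ht hp)).add
    ((hb t).hasDerivWithinAt.smul (hW p t ht hp))
  have hlin : ∀ x (c d : ℝ) (v w : TangentSpace 𝓘(ℝ, E) x),
      coordAt p x (c • v + d • w) = c • coordAt p x v + d • coordAt p x w := by
    intro x c d v w
    simp only [coordAt, map_add, map_smul]
  refine (h1.congr (fun τ _ ↦ hlin _ _ _ _ _) (hlin _ _ _ _ _)).congr_deriv ?_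
  have hlin' : coordAt p (γ t) (a t • V' t + a' t • V t + b t • W' t + b' t • W t) =
      a t • coordAt p (γ t) (V' t) + a' t • coordAt p (γ t) (V t) + b t • coordAt p (γ t) (W' t)
        + b' t • coordAt p (γ t) (W t) := by
    simp only [coordAt, map_add, map_smul]
  rw [hlin, hlin', christoffel_eq, christoffelOf_linear]
  module

end KaulComparison

/-! ### Quadratic forms and scalar comparison. -/

namespace KaulComparison
set_option maxSynthPendingDepth 3
open Filter Topology

/-- A symmetric endomorphism of a hyperplane whose quadratic form lies between `δ` and `Δ` is at
distance at most `(Δ - δ) / 2` from the homothety of ratio `(Δ + δ) / 2`. -/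
theorem norm_sub_smul_le_of_quadratic_bounds {V : Type*} [NormedAddCommGroup V]
    [InnerProductSpace ℝ V] {R : V → V} {e : V} {δ Δ : ℝ}
    (hsymm : ∀ u z, (inner ℝ (R u) z : ℝ) = inner ℝ (R z) u)
    (hself : ∀ u, (inner ℝ (R u) e : ℝ) = 0)
    (hb : ∀ u, (inner ℝ u e : ℝ) = 0 →
      δ * ‖u‖ ^ 2 ≤ inner ℝ (R u) u ∧ inner ℝ (R u) u ≤ Δ * ‖u‖ ^ 2)
    {u : V} (hu : (inner ℝ u e : ℝ) = 0) :
    ‖R u - ((Δ + δ) / 2) • u‖ ≤ (Δ - δ) / 2 * ‖u‖ := by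
  -- Linearity of `R` is not assumed; it follows weakly from self-adjointness.
  have hR : ∀ (a b : ℝ) (x y z : V), (inner ℝ (R (a • x + b • y)) z : ℝ) =
      a * inner ℝ (R x) z + b * inner ℝ (R y) z := fun a b x y z ↦ by
    rw [hsymm, inner_add_right, real_inner_smul_right, real_inner_smul_right, hsymm z x, hsymm z y]
  set s := R u - ((Δ + δ) / 2) • u with hs
  have hse : (inner ℝ s e : ℝ) = 0 := by
    rw [hs, inner_sub_left, real_inner_smul_left, hself, hu]; ring
  have hss : ‖s‖ ^ 2 = inner ℝ (R u) s - (Δ + δ) / 2 * inner ℝ u s := by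
    rw [← real_inner_self_eq_norm_sq]
    conv_lhs => rw [hs, inner_sub_left, real_inner_smul_left, ← hs]
  -- Polarization: the upper bound at `a u + b s` minus the lower bound at `a u - b s`.
  have hab : ∀ a b : ℝ, 4 * (a * b) * ‖s‖ ^ 2 ≤
      (Δ - δ) * (a ^ 2 * ‖u‖ ^ 2 + b ^ 2 * ‖s‖ ^ 2) := by
    intro a b
    have hperp : ∀ b : ℝ, (inner ℝ (a • u + b • s) e : ℝ) = 0 := fun b ↦ by
      rw [inner_add_left, real_inner_smul_left, real_inner_smul_left, hu, hse]; ring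
    have h1 := (hb _ (hperp b)).2
    have h2 := (hb _ (hperp (-b))).1
    rw [hR, inner_add_right, inner_add_right, real_inner_smul_right, real_inner_smul_right,
      real_inner_smul_right, real_inner_smul_right, hsymm s u, norm_add_sq_real, norm_smul, norm_smul,
      mul_pow, mul_pow, real_inner_smul_left, real_inner_smul_right, Real.norm_eq_abs,
      Real.norm_eq_abs, sq_abs, sq_abs] at h1 h2
    rw [hss] at *
    nlinarith
  rcases eq_or_ne ‖u‖ 0 with h0 | h0
  · have h1 : u = 0 := norm_eq_zero.1 h0
    have h2 : (inner ℝ (R u) s : ℝ) = 0 := by rw [hsymm, h1, inner_zero_right]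
    rw [h2, h1, inner_zero_left] at hss
    have : ‖s‖ = 0 := by simpa using hss
    rw [this, h0, mul_zero]
  · have hpos : 0 < ‖u‖ := lt_of_le_of_ne (norm_nonneg u) (Ne.symm h0)
    rcases eq_or_ne ‖s‖ 0 with hs0 | hs0
    · have := hb u hu
      have h3 : 0 ≤ (Δ - δ) * ‖u‖ ^ 2 := by linarith
      have h4 : 0 ≤ Δ - δ := nonneg_of_mul_nonneg_left h3 (by positivity)
      rw [hs0]; positivity
    · have hspos : 0 < ‖s‖ := lt_of_le_of_ne (norm_nonneg s) (Ne.symm hs0)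
      -- These weights make the two terms on the right equal.
      have h := hab ‖s‖ ‖u‖
      have h5 : ‖s‖ * (4 * ‖s‖ ^ 2 * ‖u‖) ≤ ((Δ - δ) / 2 * ‖u‖) * (4 * ‖s‖ ^ 2 * ‖u‖) := by
        linarith
      exact le_of_mul_le_mul_right h5 (by positivity)

/-- The square root is not differentiable at zeros of `N`, so `√(N + ε²) - g` is shown to decrease;
it starts at `ε`, which is then arbitrary. -/
theorem sqrt_le_of_hasDerivWithinAt_le {N N' g g' : ℝ → ℝ} {a : ℝ}
    (hN : ∀ t ∈ Icc 0 a, HasDerivWithinAt N (N' t) (Icc 0 a) t)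
    (hg : ∀ t ∈ Icc 0 a, HasDerivWithinAt g (g' t) (Icc 0 a) t)
    (hN0 : ∀ t ∈ Icc 0 a, 0 ≤ N t) (hg' : ∀ t ∈ Icc 0 a, 0 ≤ g' t)
    (h : ∀ t ∈ Icc 0 a, N' t ≤ 2 * √(N t) * g' t) (hN00 : N 0 = 0) (hg0 : g 0 = 0)
    {t : ℝ} (ht : t ∈ Icc 0 a) : √(N t) ≤ g t := by
  refine le_of_forall_pos_le_add fun ε hε ↦ ?_
  have hpos : ∀ t ∈ Icc 0 a, 0 < N t + ε ^ 2 := fun t ht ↦ by have := hN0 t ht; positivity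
  have hder : ∀ t ∈ Icc 0 a, HasDerivWithinAt (fun t ↦ √(N t + ε ^ 2) - g t)
      (N' t / (2 * √(N t + ε ^ 2)) - g' t) (Icc 0 a) t := fun t ht ↦
    (((hN t ht).add_const (ε ^ 2)).sqrt (hpos t ht).ne').sub (hg t ht)
  have hanti : AntitoneOn (fun t ↦ √(N t + ε ^ 2) - g t) (Icc 0 a) := by
    refine antitoneOn_of_hasDerivWithinAt_nonpos (convex_Icc 0 a)
      (fun t ht ↦ (hder t ht).continuousWithinAt)
      (fun t ht ↦ (hder t (interior_subset ht)).mono interior_subset) fun t ht ↦ ?_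
    replace ht := interior_subset ht
    have hsq : √(N t) ≤ √(N t + ε ^ 2) := Real.sqrt_le_sqrt (by nlinarith)
    have hsp : 0 < √(N t + ε ^ 2) := Real.sqrt_pos.2 (hpos t ht)
    rw [sub_nonpos, div_le_iff₀ (by positivity)]
    nlinarith [h t ht, mul_le_mul_of_nonneg_right hsq (hg' t ht)]
  have h1 := hanti (left_mem_Icc.2 (ht.1.trans ht.2)) ht ht.1
  have h2 : √(N t) ≤ √(N t + ε ^ 2) := Real.sqrt_le_sqrt (by nlinarith)
  simp only [hN00, hg0, zero_add, Real.sqrt_sq hε.le, sub_zero] at h1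
  linarith

/-- The generalized sine and cosine functions. -/
theorem exists_generalized_sine (c : ℝ) : ∃ sn cn : ℝ → ℝ, (∀ t, HasDerivAt sn (cn t) t) ∧
    (∀ t, HasDerivAt cn (-c * sn t) t) ∧ sn 0 = 0 ∧ cn 0 = 1 ∧
    ∀ t : ℝ, 0 ≤ t → (t : EReal) ≤ genPi c → 0 ≤ sn t := by
  rcases lt_trichotomy c 0 with hc | rfl | hc
  · have hk : 0 < √(-c) := Real.sqrt_pos.2 (by linarith)
    have hk2 : √(-c) * √(-c) = -c := Real.mul_self_sqrt (by linarith)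
    refine ⟨fun t ↦ Real.sinh (√(-c) * t) / √(-c), fun t ↦ Real.cosh (√(-c) * t), fun t ↦ ?_,
      fun t ↦ ?_, by simp, by simp, fun t ht _ ↦ ?_⟩
    · have := (((hasDerivAt_id t).const_mul √(-c)).sinh).div_const √(-c)
      refine this.congr_deriv ?_
      simp; field_simp
    · refine (((hasDerivAt_id t).const_mul √(-c)).cosh).congr_deriv ?_
      simp only [id, mul_one]
      rw [← mul_div_assoc, eq_div_iff hk.ne', mul_assoc, hk2, mul_comm]
    · exact div_nonneg (Real.sinh_nonneg_iff.2 (by positivity)) hk.le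
  · refine ⟨fun t ↦ t, fun _ ↦ 1, fun t ↦ hasDerivAt_id t, fun t ↦ ?_, rfl, rfl, fun t ht _ ↦ ht⟩
    simpa using hasDerivAt_const t (1 : ℝ)
  · have hk : 0 < √c := Real.sqrt_pos.2 hc
    have hk2 : √c * √c = c := Real.mul_self_sqrt hc.le
    refine ⟨fun t ↦ Real.sin (√c * t) / √c, fun t ↦ Real.cos (√c * t), fun t ↦ ?_,
      fun t ↦ ?_, by simp, by simp, fun t ht hle ↦ ?_⟩
    · have := (((hasDerivAt_id t).const_mul √c).sin).div_const √c
      refine this.congr_deriv ?_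
      simp; field_simp
    · refine (((hasDerivAt_id t).const_mul √c).cos).congr_deriv ?_
      simp only [id, mul_one]
      rw [← mul_div_assoc, eq_div_iff hk.ne', mul_assoc, hk2]; ring
    · rw [genPi, if_pos hc, EReal.coe_le_coe_iff, le_div_iff₀ hk] at hle
      exact div_nonneg (Real.sin_nonneg_of_nonneg_of_le_pi (by positivity) (by linarith)) hk.le

/-- Grönwall's inequality, by the integrating factor `exp (-K t)`. -/
theorem eq_zero_of_hasDerivAt_le_mul {G w : ℝ → ℝ} {K T : ℝ} (hT : 0 ≤ T)
    (hG : ∀ t, HasDerivAt G (w t) t) (hG0 : G 0 = 0) (h : ∀ t ∈ Icc 0 T, w t ≤ K * G t) :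
    G T ≤ 0 := by
  have hder : ∀ t, HasDerivAt (fun t ↦ Real.exp (-K * t) * G t)
      (Real.exp (-K * t) * (w t - K * G t)) t := fun t ↦ by
    refine ((((hasDerivAt_id t).const_mul (-K)).exp).mul (hG t)).congr_deriv ?_
    simp only [id]; ring
  have hanti : AntitoneOn (fun t ↦ Real.exp (-K * t) * G t) (Icc 0 T) := by
    refine antitoneOn_of_hasDerivWithinAt_nonpos (convex_Icc 0 T)
      (fun t _ ↦ (hder t).continuousAt.continuousWithinAt)
      (fun t _ ↦ (hder t).hasDerivWithinAt) fun t ht ↦ ?_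
    have := h t (interior_subset ht)
    exact mul_nonpos_of_nonneg_of_nonpos (Real.exp_pos _).le (by linarith)
  have h1 := hanti (left_mem_Icc.2 hT) (right_mem_Icc.2 hT) hT
  simp only [hG0, mul_zero] at h1
  exact nonpos_of_mul_nonpos_right h1 (Real.exp_pos _)

/-- If `x` is bounded by every function which satisfies the integrated form of
`g'' + c g ≥ η + ε x`, then `x` is bounded by the solution of `ρ'' + (c - ε) ρ = η`. -/
theorem le_of_integrated_comparison {c ε T : ℝ} {sn cn x η ρ ρ' ρ'' : ℝ → ℝ} (hT : 0 ≤ T)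
    (hε : 0 ≤ ε) (hsn : ∀ t, HasDerivAt sn (cn t) t) (hcn : ∀ t, HasDerivAt cn (-c * sn t) t)
    (hsn0 : sn 0 = 0) (hcn0 : cn 0 = 1) (hsn_nonneg : ∀ t ∈ Icc 0 T, 0 ≤ sn t)
    (hρ : ∀ t ∈ Icc 0 T, HasDerivWithinAt ρ (ρ' t) (Icc 0 T) t)
    (hρ' : ∀ t ∈ Icc 0 T, HasDerivWithinAt ρ' (ρ'' t) (Icc 0 T) t)
    (hode : ∀ t ∈ Icc 0 T, ρ'' t + (c - ε) * ρ t = η t) (hρ0 : ρ 0 = 0) (hρ'0 : ρ' 0 = 0)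
    (hx : ContinuousOn x (Icc 0 T))
    (hcomp : ∀ t ∈ Icc 0 T, ∀ g g' : ℝ → ℝ,
      (∀ s ∈ Icc 0 t, HasDerivWithinAt g (g' s) (Icc 0 t) s) → g 0 = 0 →
      (∀ s ∈ Icc 0 t, sn (t - s) * (η s + ε * x s) ≤ g' s) → x t ≤ g t) :
    x T ≤ ρ T := by
  obtain ⟨S, hS⟩ := (isCompact_Icc (a := (0 : ℝ)) (b := T)).exists_bound_of_continuousOn
    (f := sn) fun t _ ↦ (hsn t).continuousAt.continuousWithinAt
  have hS0 : 0 ≤ S := (norm_nonneg _).trans (hS 0 (left_mem_Icc.2 hT))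
  have hρc : ContinuousOn ρ (Icc 0 T) := fun t ht ↦ (hρ t ht).continuousWithinAt
  have hmc : ContinuousOn (fun t ↦ max 0 (x t - ρ t)) (Icc 0 T) :=
    continuousOn_const.sup (hx.sub hρc)
  -- The positive part of `x - ρ`, extended continuously to `ℝ` so that its primitive `G` is
  -- differentiable everywhere.
  set w : ℝ → ℝ := IccExtend hT ((Icc 0 T).domRestrict fun t ↦ max 0 (x t - ρ t)) with hw
  have hwc : Continuous w := hmc.domRestrict.Icc_extend'
  have hwt : ∀ t ∈ Icc 0 T, w t = max 0 (x t - ρ t) := fun t ht ↦ by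
    rw [hw, IccExtend_of_mem _ _ ht]; rfl
  have hw0 : ∀ t, 0 ≤ w t := fun t ↦ le_max_left _ _
  set G : ℝ → ℝ := fun t ↦ ∫ s in (0 : ℝ)..t, w s with hG
  have hGd : ∀ t, HasDerivAt G (w t) t := fun t ↦
    intervalIntegral.integral_hasDerivAt_right (hwc.intervalIntegrable _ _)
      hwc.aestronglyMeasurable.stronglyMeasurableAtFilter hwc.continuousAt
  have hG0 : G 0 = 0 := intervalIntegral.integral_same
  have hGnn : ∀ t, 0 ≤ t → 0 ≤ G t := fun t ht ↦
    intervalIntegral.integral_nonneg ht fun s _ ↦ hw0 s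
  have hsub : ∀ t s, t ∈ Icc 0 T → s ∈ Icc 0 t → s ∈ Icc 0 T ∧ t - s ∈ Icc 0 T :=
    fun t s ht hs ↦ ⟨⟨hs.1, hs.2.trans ht.2⟩, ⟨by linarith [hs.2], by linarith [hs.1, ht.2]⟩⟩
  have key : ∀ t ∈ Icc 0 T, x t ≤ ρ t + ε * S * G t := by
    intro t ht
    -- The test function for `hcomp`: the first two terms are variation of constants for `ρ'' + c ρ
    -- = η + ε ρ`, with value `ρ t` at `s = t`; the term `ε S G` absorbs the excess of `x` over `ρ`.
    have hder : ∀ s ∈ Icc 0 t, HasDerivWithinAt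
        (fun s ↦ sn (t - s) * ρ' s + cn (t - s) * ρ s + ε * S * G s)
        (sn (t - s) * (η s + ε * ρ s) + ε * S * w s) (Icc 0 t) s := by
      intro s hs
      have hmono : Icc 0 t ⊆ Icc 0 T := Icc_subset_Icc_right ht.2
      have h1 : HasDerivAt (fun s ↦ t - s) (-1) s := by
        simpa using (hasDerivAt_id s).const_sub t
      have h2 := ((hsn (t - s)).comp s h1).hasDerivWithinAt (s := Icc 0 t)
      have h3 := ((hcn (t - s)).comp s h1).hasDerivWithinAt (s := Icc 0 t)
      have h4 := (h2.mul ((hρ' s (hmono hs)).mono hmono)).add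
        (h3.mul ((hρ s (hmono hs)).mono hmono)) |>.add
        ((hGd s).hasDerivWithinAt.const_mul (ε * S))
      refine h4.congr_deriv ?_
      rw [← hode s (hmono hs)]
      simp only [Function.comp_apply]
      ring
    have := hcomp t ht _ _ hder (by simp [hρ0, hρ'0, hG0]) fun s hs ↦ by
      obtain ⟨hs1, hs2⟩ := hsub t s ht hs
      have h1 : x s - ρ s ≤ w s := by rw [hwt s hs1]; exact le_max_right _ _
      have h2 := hsn_nonneg _ hs2
      have h3 : sn (t - s) ≤ S := (le_abs_self _).trans (hS _ hs2)
      have h4 : sn (t - s) * (ε * (x s - ρ s)) ≤ sn (t - s) * (ε * w s) := by gcongr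
      have h5 : sn (t - s) * (ε * w s) ≤ S * (ε * w s) :=
        mul_le_mul_of_nonneg_right h3 (mul_nonneg hε (hw0 s))
      linarith
    simpa [hsn0, hcn0] using this
  have hGT := eq_zero_of_hasDerivAt_le_mul (K := ε * S) hT hGd hG0 fun t ht ↦ by
    rw [hwt t ht]
    refine max_le (mul_nonneg (mul_nonneg hε hS0) (hGnn t ht.1)) ?_
    linarith [key t ht]
  have hT' := key T (right_mem_Icc.2 hT)
  rwa [le_antisymm hGT (hGnn T hT), mul_zero, add_zero] at hT'

end KaulComparison

/-! ### Consequences of the curvature bounds, and growth of fields along curves. -/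

namespace KaulComparison
set_option maxSynthPendingDepth 3
open Filter Topology

variable {E : Type*} [NormedAddCommGroup E] [NormedSpace ℝ E] [FiniteDimensional ℝ E]
  {M : Type*} [TopologicalSpace M] [ChartedSpace E M] [IsManifold 𝓘(ℝ, E) 1 M]
  [IsManifold 𝓘(ℝ, E) 4 M] [RiemannianBundle (fun x : M ↦ TangentSpace 𝓘(ℝ, E) x)]
  [IsContMDiffRiemannianBundle 𝓘(ℝ, E) 3 E (fun x : M ↦ TangentSpace 𝓘(ℝ, E) x)]

-- Dimension at least two provides a tangent plane on which to compare the bounds; this makes `(Δ -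
-- δ) / 2` nonnegative.
omit [FiniteDimensional ℝ E] [IsManifold 𝓘(ℝ, E) 4 M]
  [IsContMDiffRiemannianBundle 𝓘(ℝ, E) 3 E (fun x : M ↦ TangentSpace 𝓘(ℝ, E) x)] in
theorem le_of_sec_bounds {δ Δ : ℝ} (hdim : 2 ≤ Module.finrank ℝ E)
    (hsec : ∀ (x : M) (u v : TangentSpace 𝓘(ℝ, E) x), LinearIndependent ℝ ![u, v] →
      δ ≤ sec x u v ∧ sec x u v ≤ Δ) (x : M) : δ ≤ Δ := by
  obtain ⟨u, hu⟩ : ∃ u : E, u ≠ 0 := by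
    have : Nontrivial E := Module.nontrivial_of_finrank_pos (R := ℝ) (by omega)
    exact exists_ne 0
  obtain ⟨v, hv⟩ := exists_linearIndependent_pair_of_one_lt_finrank (R := ℝ) (M := E) (by omega) hu
  have h := hsec x u v hv
  exact h.1.trans h.2

theorem norm_riemann_sub_smul_le {δ Δ : ℝ} {x : M}
    (hsec : ∀ (u v : TangentSpace 𝓘(ℝ, E) x), LinearIndependent ℝ ![u, v] →
      δ ≤ sec x u v ∧ sec x u v ≤ Δ)
    {e u : TangentSpace 𝓘(ℝ, E) x} (he : ‖e‖ = 1) (hu : (inner ℝ u e : ℝ) = 0) :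
    ‖riemann x u e e - ((Δ + δ) / 2) • u‖ ≤ (Δ - δ) / 2 * ‖u‖ := by
  refine norm_sub_smul_le_of_quadratic_bounds (R := fun u ↦ riemann x u e e) (e := e)
    (fun u z ↦ inner_riemann_symm u e z) (fun u ↦ inner_riemann_self u e) (fun u hu ↦ ?_) hu
  rcases eq_or_ne u 0 with rfl | h0
  · simp
  have hpos : 0 < ‖u‖ ^ 2 := by positivity
  have hind : LinearIndependent ℝ ![u, e] := by
    rw [LinearIndependent.pair_iff]
    intro a b hab
    have ha := congrArg (fun z ↦ (inner ℝ u z : ℝ)) hab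
    have hb := congrArg (fun z ↦ (inner ℝ z e : ℝ)) hab
    simp only [inner_add_right, inner_add_left, real_inner_smul_left, real_inner_smul_right, hu,
      real_inner_self_eq_norm_sq, he, inner_zero_left, inner_zero_right] at ha hb
    refine ⟨?_, by linarith⟩
    have : a * ‖u‖ ^ 2 = 0 := by linarith
    exact (mul_eq_zero.1 this).resolve_right hpos.ne'
  have h := hsec u e hind
  rw [sec, he, hu] at h
  norm_num at h
  rwa [le_div_iff₀ hpos, div_le_iff₀ hpos] at h

/-- Along a curve, the norm of a vector field which vanishes initially is bounded by every
antiderivative of a bound for the norm of its covariant derivative. -/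
theorem HasCovDerivAlong.norm_le {γ : ℝ → M} {r : ℝ}
    (hγ : MDifferentiableOn 𝓘(ℝ, ℝ) 𝓘(ℝ, E) γ (Icc 0 r))
    {V V' : ∀ t, TangentSpace 𝓘(ℝ, E) (γ t)} (hV : HasCovDerivAlong γ r V V') (hV0 : V 0 = 0)
    {t : ℝ} (ht : t ∈ Icc 0 r) {g g' : ℝ → ℝ}
    (hg : ∀ s ∈ Icc 0 t, HasDerivWithinAt g (g' s) (Icc 0 t) s) (hg0 : g 0 = 0)
    (h : ∀ s ∈ Icc 0 t, ‖V' s‖ ≤ g' s) : ‖V t‖ ≤ g t := by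
  have hmono : Icc 0 t ⊆ Icc 0 r := Icc_subset_Icc_right ht.2
  have h1 := sqrt_le_of_hasDerivWithinAt_le (a := t) (g := g) (g' := g')
    (N := fun τ ↦ (inner ℝ (V τ) (V τ) : ℝ))
    (fun s hs ↦ (hV.hasDerivWithinAt_inner hγ hV (hmono hs)).mono hmono) hg (fun s _ ↦ real_inner_self_nonneg)
    (fun s hs ↦ (norm_nonneg _).trans (h s hs)) (fun s hs ↦ ?_) (by simp [hV0]) hg0
    (right_mem_Icc.2 ht.1)
  · rwa [← norm_eq_sqrt_real_inner] at h1
  · have h2 : (inner ℝ (V s) (V' s) : ℝ) ≤ ‖V s‖ * g' s :=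
      (real_inner_le_norm _ _).trans (mul_le_mul_of_nonneg_left (h s hs) (norm_nonneg _))
    rw [← norm_eq_sqrt_real_inner, real_inner_comm (V s) (V' s)]
    linarith

end KaulComparison
-- The comparison theorem.
theorem mainTheorem11
    {E : Type*} [NormedAddCommGroup E] [NormedSpace ℝ E] [FiniteDimensional ℝ E]
    (hdim : 2 ≤ Module.finrank ℝ E)
    {M : Type*} [TopologicalSpace M] [ChartedSpace E M]
    [IsManifold 𝓘(ℝ, E) 1 M] [IsManifold 𝓘(ℝ, E) 4 M]
    [RiemannianBundle (fun x : M ↦ TangentSpace 𝓘(ℝ, E) x)]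
    [IsContMDiffRiemannianBundle 𝓘(ℝ, E) 3 E (fun x : M ↦ TangentSpace 𝓘(ℝ, E) x)]
    (δ Δ : ℝ)
    (hsec : ∀ (x : M) (u v : TangentSpace 𝓘(ℝ, E) x), LinearIndependent ℝ ![u, v] →
      δ ≤ KaulComparison.sec x u v ∧ KaulComparison.sec x u v ≤ Δ)
    (r : ℝ) (hr : 0 < r)
    (γ : ℝ → M) (hγ : KaulComparison.IsGeodesic (E := E) γ r)
    (X X' X'' Y : ∀ t, TangentSpace 𝓘(ℝ, E) (γ t))
    (hXperp : ∀ t ∈ Icc 0 r, inner ℝ (X t) (KaulComparison.velocity γ r t) = 0)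
    (hYperp : ∀ t ∈ Icc 0 r, inner ℝ (Y t) (KaulComparison.velocity γ r t) = 0)
    (hX : KaulComparison.HasCovDerivAlong γ r X X')
    (hX' : KaulComparison.HasCovDerivAlong γ r X' X'')
    (hode : ∀ t ∈ Icc 0 r,
      X'' t + KaulComparison.riemann (γ t) (X t) (KaulComparison.velocity γ r t)
        (KaulComparison.velocity γ r t) = Y t)
    (hX0 : X 0 = 0) (hX'0 : X' 0 = 0)
    (η : ℝ → ℝ) (hη : ContinuousOn η (Icc 0 r)) (hYη : ∀ t ∈ Icc 0 r, ‖Y t‖ ≤ η t)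
    (ρ ρ' ρ'' : ℝ → ℝ)
    (hρ : ∀ t ∈ Icc 0 r, HasDerivWithinAt ρ (ρ' t) (Icc 0 r) t)
    (hρ' : ∀ t ∈ Icc 0 r, HasDerivWithinAt ρ' (ρ'' t) (Icc 0 r) t)
    (hρode : ∀ t ∈ Icc 0 r, ρ'' t + δ * ρ t = η t)
    (hρ0 : ρ 0 = 0) (hρ'0 : ρ' 0 = 0) :
    ∀ t : ℝ, 0 ≤ t → (t : EReal) ≤ min (r : EReal) (KaulComparison.genPi ((Δ + δ) / 2)) →
      ‖X t‖ ≤ ρ t := by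
  intro T hT0 hT
  have hTr : T ≤ r := EReal.coe_le_coe_iff.1 (hT.trans (min_le_left _ _))
  have hTpi := hT.trans (min_le_right _ _)
  have hmono : Icc 0 T ⊆ Icc 0 r := Icc_subset_Icc_right hTr
  have hγd : MDifferentiableOn 𝓘(ℝ, ℝ) 𝓘(ℝ, E) γ (Icc 0 r) :=
    hγ.contMDiffOn.mdifferentiableOn (by norm_num)
  have hδΔ := KaulComparison.le_of_sec_bounds hdim hsec (γ 0)
  have hε : 0 ≤ (Δ - δ) / 2 := by linarith
  obtain ⟨sn, cn, hsn, hcn, hsn0, hcn0, hsnn⟩ :=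
    KaulComparison.exists_generalized_sine ((Δ + δ) / 2)
  have hsnn' : ∀ t ∈ Icc 0 T, 0 ≤ sn t := fun t ht ↦
    hsnn t ht.1 ((EReal.coe_le_coe_iff.2 ht.2).trans hTpi)
  refine KaulComparison.le_of_integrated_comparison (x := fun t ↦ ‖X t‖) hT0 hε hsn hcn hsn0 hcn0
    hsnn' (fun t ht ↦ (hρ t (hmono ht)).mono hmono) (fun t ht ↦ (hρ' t (hmono ht)).mono hmono)
    (η := η) (fun t ht ↦ ?_) hρ0 hρ'0 (fun t ht ↦ ?_) fun t ht g g' hg hg0 hle ↦ ?_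
  · rw [← hρode t (hmono ht)]; ring
  · have h := ((hX.hasDerivWithinAt_inner hγd hX (hmono ht)).continuousWithinAt.mono hmono).sqrt
    simpa only [← norm_eq_sqrt_real_inner] using h
  -- This field vanishes at `s = 0` and equals `X t` at `s = t`; in its covariant derivative the
  -- `X'` terms cancel.
  · have hV := hX'.smul_add_smul hX (a := fun s ↦ sn (t - s)) (b := fun s ↦ cn (t - s))
      (fun s ↦ (hsn (t - s)).comp s ((hasDerivAt_id s).const_sub t))
      (fun s ↦ (hcn (t - s)).comp s ((hasDerivAt_id s).const_sub t))
    have h := hV.norm_le hγd (by simp [hX0, hX'0]) (hmono ht) hg hg0 fun s hs ↦ ?_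
    · simpa [hsn0, hcn0] using h
    have hs' : s ∈ Icc 0 r := ⟨hs.1, hs.2.trans (ht.2.trans hTr)⟩
    have h1 := KaulComparison.norm_riemann_sub_smul_le (hsec (γ s)) (hγ.norm_velocity s hs')
      (hXperp s hs')
    have h2 : sn (t - s) • X'' s + (cn (t - s) * -1) • X' s + cn (t - s) • X' s
        + (-((Δ + δ) / 2) * sn (t - s) * -1) • X s =
        sn (t - s) • (Y s - (KaulComparison.riemann (γ s) (X s) (KaulComparison.velocity γ r s)
          (KaulComparison.velocity γ r s) - ((Δ + δ) / 2) • X s)) := by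
      rw [← hode s hs']
      module
    have h3 : 0 ≤ sn (t - s) := hsnn' _ ⟨by linarith [hs.2], by linarith [hs.1, ht.2]⟩
    refine le_trans ?_ (hle s hs)
    rw [h2, norm_smul, Real.norm_of_nonneg h3]
    exact mul_le_mul_of_nonneg_left ((norm_sub_le _ _).trans (add_le_add (hYη s hs') h1)) h3
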